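/- Let $p$ be an odd prime and let $n, g \ge 0$ be integers. A linear code $C \subseteq \mathbb{F}_p^n$ is self-dual if $C = C^\perp$ for the inner product $c\cdot c'=\sum_{j} c_j c'_j$; let $\mathcal{M}_{n,p}$ be the set of all self-dual codes in $\mathbb{F}_p^n$. The genus-$g$ weight enumerator of $C$ is the polynomial in variables $x_v$, $v\in\mathbb{F}_p^g$, $$W_{g,C}(\{x_v\})=\sum_{(c^{(1)},\dots,c^{(g)})\in C^g}\ \prod_{v\in\mathbb{F}_p^g} x_v^{\mathrm{wt}_v(c^{(1)},\dots,c^{(g)})},\qquad \mathrm{wt}_v(c^{(1)},\dots,c^{(g)})=\bigl|\{j\in\{1,\dots,n\} : c^{(i)}_j=v_i \text{ for } i=1,\dots,g\}\bigr|.$$ For a tuple $A=(e_v)_{v\in\mathbb{F}_p^g}$ of non-negative integers put $x^A=\prod_v x_v^{e_v}$ and $\dim_p(A)=\dim_{\mathbb{F}_p}\langle v : e_v>0\rangle$. The tuple $A$ is called $p$-admissible if (i) $\sum_v e_v=n$, where $n\equiv 0 \pmod 2$ if $p\equiv 1\pmod 4$ and $n\equiv 0\pmod 4$ if $p\equiv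 3\pmod 4$; and (ii) $\sum_v e_v\,(v S v^T)\equiv 0 \pmod p$ for every symmetric integral $g\times g$ matrix $S$. For a $p$-admissible $A$ put $\binom{n}{A}=n!/\prod_v e_v!$. Then $\mathcal{M}_{n,p}$ is non-empty if and only if $n\in 2\mathbb{Z}$ (when $p\equiv 1 \bmod 4$), respectively $n\in 4\mathbb{Z}$ (when $p\equiv 3\bmod 4$). In that case the average of the genus-$g$ weight enumerators over $\mathcal{M}_{n,p}$ is $$\frac{1}{|\mathcal{M}_{n,p}|}\sum_{C\in\mathcal{M}_{n,p}} W_{g,C}(\{x_v\})=\sum_{A}\ \frac{1}{\prod_{i=1}^{\dim_p(A)}\bigl(p^{\frac n2-i}+1\bigr)}\binom{n}{A}\,x^A,$$ where the sum runs over all $p$-admissible tuples $A$, and an empty product equals $1$. -/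

import Mathlib

open scoped Matrix

noncomputable section

namespace CodeAverage

/-- The dual of a linear code `C ⊆ 𝔽_p^n` for the Euclidean inner product `c · c' = ∑ᵢ cᵢ c'ᵢ`. -/
def dualCode {p n : ℕ} (C : Submodule (ZMod p) (Fin n → ZMod p)) :
    Submodule (ZMod p) (Fin n → ZMod p) where
  carrier := {c' | ∀ c ∈ C, c ⬝ᵥ c' = 0}
  add_mem' := by
    intro a b ha hb c hc
    rw [dotProduct_add, ha c hc, hb c hc, add_zero]
  zero_mem' := by
    intro c _
    exact dotProduct_zero c
  smul_mem' := by
    intro r a ha c hc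
    rw [dotProduct_smul, ha c hc, smul_zero]

/-- The finite set `ℳ_{n,p}` of all self-dual codes `C = C^⊥` in `𝔽_p^n`. -/
def selfDualCodes (p n : ℕ) [NeZero p] :
    Finset (Submodule (ZMod p) (Fin n → ZMod p)) :=
  (Set.toFinite {C : Submodule (ZMod p) (Fin n → ZMod p) | C = dualCode C}).toFinset

theorem mem_selfDualCodes {p n : ℕ} [NeZero p]
    (C : Submodule (ZMod p) (Fin n → ZMod p)) :
    C ∈ selfDualCodes p n ↔ C = dualCode C := by
  simp [selfDualCodes]

/-- `wt_v(c⁽¹⁾, …, c⁽ᵍ⁾)`: the number of coordinates `j` such that `c⁽ⁱ⁾_j = v_i` for all `i`. -/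
def wt {p n g : ℕ} (c : Fin g → Fin n → ZMod p) (v : Fin g → ZMod p) : ℕ :=
  (Finset.univ.filter fun j : Fin n => ∀ i : Fin g, c i j = v i).card

/-- The monomial `x^A = ∏_v x_v^{e_v}` of a tuple `A = (e_v | v ∈ 𝔽_p^g)`. -/
def tupleMonomial {p g : ℕ} [NeZero p] (A : (Fin g → ZMod p) → ℕ) :
    MvPolynomial (Fin g → ZMod p) ℚ :=
  ∏ v, MvPolynomial.X v ^ A v

open Classical in
/-- The genus-`g` weight enumerator
`W_{g,C} = ∑_{(c⁽¹⁾, …, c⁽ᵍ⁾) ∈ C^g} ∏_v x_v ^ wt_v(c⁽¹⁾, …, c⁽ᵍ⁾)`. -/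
def genusWeightEnumerator {p n : ℕ} [NeZero p] (g : ℕ)
    (C : Submodule (ZMod p) (Fin n → ZMod p)) : MvPolynomial (Fin g → ZMod p) ℚ :=
  ∑ c : Fin g → Fin n → ZMod p with ∀ i, c i ∈ C, ∏ v, MvPolynomial.X v ^ wt c v

/-- The average `E^{(g)}_{n,p}` of the genus-`g` weight enumerators over all self-dual codes. -/
def averageEnumerator (p n g : ℕ) [NeZero p] : MvPolynomial (Fin g → ZMod p) ℚ :=
  (1 / ((selfDualCodes p n).card : ℚ)) • ∑ C ∈ selfDualCodes p n, genusWeightEnumerator g C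

/-- The condition `n ∈ 2ℤ` if `p ≡ 1 mod 4`, and `n ∈ 4ℤ` if `p ≡ 3 mod 4`. -/
def LengthCondition (p n : ℕ) : Prop :=
  (p % 4 = 1 → 2 ∣ n) ∧ (p % 4 = 3 → 4 ∣ n)

/-- `dim_p(A)`: the dimension of the span of `{v ∈ 𝔽_p^g | e_v > 0}`. -/
def tupleDim {p g : ℕ} (A : (Fin g → ZMod p) → ℕ) : ℕ :=
  Module.finrank (ZMod p) (Submodule.span (ZMod p) {v : Fin g → ZMod p | 0 < A v})

/-- The tuple `A = (e_v | v ∈ 𝔽_p^g)` is `p`-admissible: the `e_v` sum to `n`, where `n` satisfies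
the length condition, and `∑_v e_v (v S vᵀ) = 0` in `𝔽_p` for every integral symmetric
`g × g` matrix `S`. -/
def IsAdmissible {p g : ℕ} [NeZero p] (n : ℕ) (A : (Fin g → ZMod p) → ℕ) : Prop :=
  (∑ v, A v = n ∧ LengthCondition p n) ∧
    ∀ S : Matrix (Fin g) (Fin g) ℤ, S.IsSymm →
      ∑ v, (A v : ZMod p) * (v ⬝ᵥ (S.map (Int.cast : ℤ → ZMod p) *ᵥ v)) = 0

open Classical in
/-- The finite set of all `p`-admissible tuples. -/
def admissibleTuples (p n g : ℕ) [NeZero p] : Finset ((Fin g → ZMod p) → ℕ) :=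
  (Finset.piAntidiag Finset.univ n).filter fun A => IsAdmissible n A

theorem mem_admissibleTuples {p n g : ℕ} [NeZero p] (A : (Fin g → ZMod p) → ℕ) :
    A ∈ admissibleTuples p n g ↔ IsAdmissible n A := by
  simp only [admissibleTuples, Finset.mem_filter, Finset.mem_piAntidiag, Finset.mem_univ,
    implies_true, and_true]
  exact ⟨fun h => h.2, fun h => ⟨h.1.1, h⟩⟩

/-- The multinomial coefficient `n! / ∏_v e_v!`. -/
def tupleMultinomial {p g : ℕ} [NeZero p] (n : ℕ) (A : (Fin g → ZMod p) → ℕ) : ℚ :=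
  (n.factorial : ℚ) / ∏ v, ((A v).factorial : ℚ)

end CodeAverage

end

/-!
Exchanging the sums over codes and over words, the average is a sum over all tuples of words
`c = (c⁽¹⁾, …, c⁽ᵍ⁾)` of the monomial of `wt c`, weighted by the proportion of self-dual codes that
contain every `c⁽ⁱ⁾`. Four facts turn this into the stated formula.

* The number of `c` with `wt c = A` is the multinomial coefficient (`card_filter_wt_eq`).
* `wt c` is admissible exactly if the words are pairwise orthogonal, that is, if their span `U` is
  totally isotropic (`isAdmissible_wt_iff`); otherwise no self-dual code contains them.
* The dimension of `U` is `tupleDim (wt c)`, since row rank equals column rank (`tupleDim_wt`).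
* If self-dual codes exist, the number of them containing a totally isotropic `U` of dimension `d`
  is `∏_{i < n/2 - d} (p ^ i + 1)` (`card_selfDual_above`), and the quotient by the number for
  `U = 0` is `1 / ∏_{i = 1}^d (p ^ (n/2 - i) + 1)`.

The last count needs no classification of quadratic forms. By the modular law, `U` lies in the
self-dual space `U + (L ∩ U^⊥)` for any self-dual `L` (`exists_orthogonal_eq_and_le`). If `C` is
self-dual and contains `U`, then on a coset `x + C` in `U^⊥` the quadratic form is zero if `x ∈ C`
and is affine and nonconstant if not, which gives the number of isotropic vectors in `U^⊥`
(`card_isotropic_in_orthogonal`). Counting the pairs `x ∈ C \ U` then leads from `U + ⟨x⟩` to `U`.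

Self-dual codes of admissible length are the graphs of matrices `M` with `M Mᵀ = -1`. Conversely, a
self-dual code has even length, and one of length `n ≡ 2 mod 4` for `p ≡ 3 mod 4`, compared with
those of length `n + 2`, would make `-1` a square (`isSquare_neg_one_of_dualCode_eq`).
-/

namespace CodeAverage

open Module Finset LinearMap.BilinForm
open LinearMap (BilinForm)

/-! ### Self-dual subspaces of a symmetric bilinear form -/

section BilinearForms

variable {K V : Type*} [Field K] [AddCommGroup V] [Module K V]

lemma orthogonal_sup (B : BilinForm K V) (U W : Submodule K V) :
    B.orthogonal (U ⊔ W) = B.orthogonal U ⊓ B.orthogonal W := by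
  apply le_antisymm
  · exact le_inf (orthogonal_le le_sup_left) (orthogonal_le le_sup_right)
  · rintro x ⟨hU, hW⟩ y hy
    obtain ⟨u, hu, w, hw, rfl⟩ := Submodule.mem_sup.1 hy
    rw [map_add, LinearMap.add_apply, hU u hu, hW w hw, add_zero]

/-- A subspace generated by a totally isotropic subspace `U` and an isotropic vector orthogonal
to `U` is totally isotropic. -/
lemma sup_span_singleton_le_orthogonal {B : BilinForm K V} (hs : B.IsSymm)
    {U : Submodule K V} (hU : U ≤ B.orthogonal U) {x : V} (hx : x ∈ B.orthogonal U)
    (hxx : B x x = 0) :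
    U ⊔ K ∙ x ≤ B.orthogonal (U ⊔ K ∙ x) := by
  rw [orthogonal_sup]
  refine sup_le (le_inf hU fun u hu => ?_) (le_inf ?_ ?_)
  · rw [mem_orthogonal_iff]
    intro y hy
    obtain ⟨a, rfl⟩ := Submodule.mem_span_singleton.1 hy
    rw [map_smul, LinearMap.smul_apply, hs.eq x u, hx u hu, smul_zero]
  · rwa [Submodule.span_singleton_le_iff_mem]
  · rw [Submodule.span_singleton_le_iff_mem, mem_orthogonal_iff]
    intro y hy
    obtain ⟨a, rfl⟩ := Submodule.mem_span_singleton.1 hy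
    rw [map_smul, LinearMap.smul_apply, hxx, smul_zero]

lemma eq_of_orthogonal_eq_of_le {B : BilinForm K V} {C D : Submodule K V}
    (hC : B.orthogonal C = C) (hD : B.orthogonal D = D) (h : C ≤ D) : C = D := by
  apply le_antisymm h
  rw [← hC, ← hD]
  exact orthogonal_le h

variable [FiniteDimensional K V]

lemma two_mul_finrank_of_orthogonal_eq {B : BilinForm K V} (hB : B.Nondegenerate)
    {C : Submodule K V} (hC : B.orthogonal C = C) : 2 * finrank K C = finrank K V := by
  have h := finrank_orthogonal hB C
  have := C.finrank_le
  rw [hC] at h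
  lia

/-- If a self-dual subspace `L` exists, every totally isotropic subspace `U` lies in a self-dual
one, namely in `U ⊔ (L ⊓ U^⊥)`. -/
lemma exists_orthogonal_eq_and_le {B : BilinForm K V} (hB : B.Nondegenerate) (hs : B.IsSymm)
    {L U : Submodule K V} (hL : B.orthogonal L = L) (hU : U ≤ B.orthogonal U) :
    ∃ C, B.orthogonal C = C ∧ U ≤ C := by
  refine ⟨U ⊔ (L ⊓ B.orthogonal U), ?_, le_sup_left⟩
  have h : B.orthogonal (L ⊓ B.orthogonal U) = L ⊔ U := by
    rw [← orthogonal_orthogonal hB hs.isRefl (L ⊔ U), orthogonal_sup, hL]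
  rw [orthogonal_sup, h, inf_comm, sup_comm L U, sup_inf_assoc_of_le L hU]

end BilinearForms

/-! ### Counting self-dual subspaces over a finite field -/

section Counting

variable {K V : Type*} [Field K] [Fintype K] [AddCommGroup V] [Module K V] [Fintype V]

open Classical in
lemma card_filter_mem_submodule (W : Submodule K V) :
    #{x : V | x ∈ W} = Fintype.card K ^ finrank K W := by
  rw [← Module.card_eq_pow_finrank (K := K) (V := W), Fintype.card_subtype]

open Classical in
/-- On a coset `x + C` of a self-dual `C` with `x ∉ C`, a fraction `1 / |K|` of the vectors is
isotropic: `B (x + c) (x + c) = B x x + 2 B x c`, and `B x` is a nonzero functional on `C`. -/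
lemma card_mul_card_isotropic_in_coset {B : BilinForm K V} (hs : B.IsSymm)
    (h2 : (2 : K) ≠ 0) {C : Submodule K V} (hC : B.orthogonal C = C) {x : V} (hx : x ∉ C) :
    Fintype.card K * #{c : V | c ∈ C ∧ B (x + c) (x + c) = 0} =
      Fintype.card K ^ finrank K C := by
  have hx' : ∃ c ∈ C, B c x ≠ 0 := by
    rw [← hC, mem_orthogonal_iff] at hx
    push Not at hx
    exact hx
  obtain ⟨c₀, hc₀, hne⟩ := hx'
  let f : C →ₗ[K] K := (2 : K) • (B x).domRestrict C
  have hf : ∀ c : C, f c = 2 * B x c := fun c => rfl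
  have hsurj : Function.Surjective f := by
    intro a
    refine ⟨(a / (2 * B c₀ x)) • ⟨c₀, hc₀⟩, ?_⟩
    rw [map_smul, hf, hs.eq x c₀, smul_eq_mul, div_mul_cancel₀]
    exact mul_ne_zero h2 hne
  have hq : ∀ c ∈ C, B (x + c) (x + c) = B x x + 2 * B x c := by
    intro c hc
    have : B c c = 0 := (hC.symm ▸ hc : c ∈ B.orthogonal C) c hc
    simp only [map_add, LinearMap.add_apply, this, hs.eq c x]
    ring
  have hfib : ∀ a : K, #{c : C | f c = a} = #{c : V | c ∈ C ∧ B (x + c) (x + c) = 0} := by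
    intro a
    rw [AddMonoidHom.card_fiber_eq_of_mem_range f (hsurj a) (hsurj (-B x x))]
    refine Finset.card_bij (fun c _ => (c : V)) ?_ ?_ ?_
    · intro c hc
      simp only [mem_filter, mem_univ, true_and] at hc ⊢
      refine ⟨c.2, ?_⟩
      rw [hq c c.2, ← hf, hc, add_neg_cancel]
    · intro c _ d _ h
      exact Subtype.ext h
    · intro c hc
      simp only [mem_filter, mem_univ, true_and] at hc
      refine ⟨⟨c, hc.1⟩, ?_, rfl⟩
      simp only [mem_filter, mem_univ, true_and]
      have := hq c hc.1
      rw [hc.2] at this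
      rw [hf]
      linear_combination -this
  have htot := Finset.card_eq_sum_card_fiberwise (f := f) (s := univ) (t := univ) (by simp)
  rw [Finset.card_univ, Module.card_eq_pow_finrank (K := K) (V := C)] at htot
  rw [htot, Finset.sum_congr rfl fun a _ => hfib a]
  simp

open Classical in
/-- The number of isotropic vectors in `U^⊥`, for `U` contained in a self-dual `C`. -/
lemma card_isotropic_in_orthogonal {B : BilinForm K V} (hB : B.Nondegenerate) (hs : B.IsSymm)
    (h2 : (2 : K) ≠ 0) {U C : Submodule K V} (hC : B.orthogonal C = C) (hUC : U ≤ C) {d k : ℕ}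
    (hd : finrank K U = d) (hV : finrank K V = 2 * (d + k)) :
    Fintype.card K * #{x : V | x ∈ B.orthogonal U ∧ B x x = 0} + Fintype.card K ^ (d + k) =
      Fintype.card K ^ (d + k + 1) + Fintype.card K ^ (d + 2 * k) := by
  set q := Fintype.card K
  have hq : 0 < q := Fintype.card_pos
  have hCr : finrank K C = d + k := by
    have := two_mul_finrank_of_orthogonal_eq hB hC
    lia
  have hCU : C ≤ B.orthogonal U := hC ▸ orthogonal_le hUC
  have hUr : finrank K (B.orthogonal U) = d + 2 * k := by
    rw [finrank_orthogonal hB]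
    lia
  have hCcard : #{c : V | c ∈ C} = q ^ (d + k) := by rw [card_filter_mem_submodule, hCr]
  -- Count the pairs `(x, c)` with `x ∈ U^⊥`, `c ∈ C` and `x + c` isotropic in two ways.
  have hcount := Finset.sum_card_bipartiteAbove_eq_sum_card_bipartiteBelow
    (s := ({x : V | x ∈ B.orthogonal U} : Finset V)) (t := ({c : V | c ∈ C} : Finset V))
    (fun x c => B (x + c) (x + c) = 0)
  have hbelow : ∀ c ∈ ({c : V | c ∈ C} : Finset V),
      #(bipartiteBelow (fun x c => B (x + c) (x + c) = 0)
        ({x : V | x ∈ B.orthogonal U} : Finset V) c) =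
      #{x : V | x ∈ B.orthogonal U ∧ B x x = 0} := by
    intro c hc
    have hcU : c ∈ B.orthogonal U := hCU (by simpa using hc)
    refine Finset.card_bij (fun x _ => x + c) ?_ ?_ ?_
    · intro x hx
      simp only [bipartiteBelow, mem_filter, mem_univ, true_and] at hx ⊢
      exact ⟨add_mem hx.1 hcU, hx.2⟩
    · intro x _ y _ h
      exact add_right_cancel h
    · intro y hy
      simp only [mem_filter, mem_univ, true_and] at hy
      refine ⟨y - c, ?_, sub_add_cancel y c⟩
      simp only [bipartiteBelow, mem_filter, mem_univ, true_and, sub_add_cancel]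
      exact ⟨sub_mem hy.1 hcU, hy.2⟩
  rw [Finset.sum_congr rfl hbelow, Finset.sum_const, hCcard, smul_eq_mul] at hcount
  have habove : ∀ x ∈ ({x : V | x ∈ B.orthogonal U} : Finset V),
      q * #(bipartiteAbove (fun x c => B (x + c) (x + c) = 0) ({c : V | c ∈ C} : Finset V) x) =
      if x ∈ C then q ^ (d + k + 1) else q ^ (d + k) := by
    intro x hx
    rw [bipartiteAbove, Finset.filter_filter]
    split_ifs with hxC
    · have hall : ({c : V | c ∈ C ∧ B (x + c) (x + c) = 0} : Finset V) =
          ({c : V | c ∈ C} : Finset V) := by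
        ext c
        simp only [mem_filter, mem_univ, true_and, and_iff_left_iff_imp]
        intro hc
        exact (hC.symm ▸ add_mem hxC hc : x + c ∈ B.orthogonal C) _ (add_mem hxC hc)
      rw [hall, hCcard, pow_succ, mul_comm]
    · rw [card_mul_card_isotropic_in_coset hs h2 hC hxC, hCr]
  have hin : #{x ∈ ({x : V | x ∈ B.orthogonal U} : Finset V) | x ∈ C} = q ^ (d + k) := by
    rw [← hCcard, Finset.filter_filter]
    congr 1
    ext x
    simpa using @hCU x
  have hsplit := Finset.card_filter_add_card_filter_not
    (s := ({x : V | x ∈ B.orthogonal U} : Finset V)) (fun x => x ∈ C)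
  rw [hin, card_filter_mem_submodule, hUr] at hsplit
  have h := congrArg (q * ·) hcount
  simp only [Finset.mul_sum] at h
  rw [Finset.sum_congr rfl habove, Finset.sum_ite, Finset.sum_const, Finset.sum_const, hin,
    smul_eq_mul, smul_eq_mul] at h
  change _ + _ = q ^ (d + 2 * k) at hsplit
  have hpos : 0 < q ^ (d + k) := pow_pos hq _
  apply Nat.eq_of_mul_eq_mul_left hpos
  rw [mul_add, mul_add, ← hsplit, mul_left_comm, ← h]
  ring

open Classical in
/-- **Number of self-dual subspaces above a totally isotropic one.** If `V` has dimension
`2 (d + k)` and contains a self-dual subspace, a totally isotropic `U` of dimension `d` lies in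
`∏_{i < k} (|K| ^ i + 1)` self-dual subspaces. Induction on `k`, counting the pairs of a self-dual
`C ≥ U` and a vector `x ∈ C \ U`: given `x`, the `C` are those above `U ⊔ K ∙ x`. -/
theorem card_selfDual_above {B : BilinForm K V} (hB : B.Nondegenerate) (hs : B.IsSymm)
    (h2 : (2 : K) ≠ 0) {L : Submodule K V} (hL : B.orthogonal L = L) (k : ℕ) :
    ∀ (d : ℕ) (U : Submodule K V), U ≤ B.orthogonal U → finrank K U = d →
      finrank K V = 2 * (d + k) →
      #{C : Submodule K V | B.orthogonal C = C ∧ U ≤ C} =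
        ∏ i ∈ range k, (Fintype.card K ^ i + 1) := by
  induction k with
  | zero =>
    intro d U hU hd hV
    have hUeq : B.orthogonal U = U := by
      refine (Submodule.eq_of_le_of_finrank_eq hU ?_).symm
      rw [finrank_orthogonal hB]
      lia
    rw [range_zero, prod_empty, Finset.card_eq_one]
    refine ⟨U, ?_⟩
    ext C
    simp only [mem_filter, mem_univ, true_and, mem_singleton]
    exact ⟨fun h => (eq_of_orthogonal_eq_of_le hUeq h.1 h.2).symm, by rintro rfl; exact ⟨hUeq, le_rfl⟩⟩
  | succ k ih =>
    intro d U hU hd hV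
    set q := Fintype.card K
    have hq : 1 < q := Fintype.one_lt_card
    obtain ⟨C₀, hC₀, hUC₀⟩ := exists_orthogonal_eq_and_le hB hs hL hU
    have hiso := card_isotropic_in_orthogonal hB hs h2 hC₀ hUC₀ hd hV
    let S : Finset (Submodule K V) := {C : Submodule K V | B.orthogonal C = C ∧ U ≤ C}
    let X : Finset V := {x : V | (x ∈ B.orthogonal U ∧ B x x = 0) ∧ x ∉ U}
    have hX : #X + q ^ d = #{x : V | x ∈ B.orthogonal U ∧ B x x = 0} := by
      rw [← Finset.card_filter_add_card_filter_not (s := {x : V | x ∈ B.orthogonal U ∧ B x x = 0})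
        (fun x => x ∈ U), Finset.filter_filter, Finset.filter_filter, add_comm, ← hd,
        ← card_filter_mem_submodule]
      congr 2
      ext x
      simp only [mem_filter, mem_univ, true_and, iff_and_self]
      exact fun hx => ⟨hU hx, hU hx x hx⟩
    have habove : ∀ C ∈ S, #(bipartiteAbove (fun C x => x ∈ C) X C) + q ^ d =
        q ^ (d + (k + 1)) := by
      intro C hC
      obtain ⟨hCC, hUC⟩ : B.orthogonal C = C ∧ U ≤ C := by simpa [S] using hC
      have hCr : finrank K C = d + (k + 1) := by
        have := two_mul_finrank_of_orthogonal_eq hB hCC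
        lia
      rw [← hCr, ← card_filter_mem_submodule C, ← hd, ← card_filter_mem_submodule U,
        ← Finset.card_filter_add_card_filter_not (s := {x : V | x ∈ C}) (fun x => x ∈ U),
        Finset.filter_filter, Finset.filter_filter, add_comm]
      congr 2
      · ext x
        simpa using @hUC x
      · ext x
        simp only [X, bipartiteAbove, mem_filter, mem_univ, true_and]
        constructor
        · exact fun h => ⟨h.2, h.1.2⟩
        · refine fun h => ⟨⟨⟨?_, ?_⟩, h.2⟩, h.1⟩
          · exact orthogonal_le hUC (hCC.symm ▸ h.1)
          · exact (hCC.symm ▸ h.1 : x ∈ B.orthogonal C) x h.1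
    have hbelow : ∀ x ∈ X, #(bipartiteBelow (fun C x => x ∈ C) S x) =
        ∏ i ∈ range k, (q ^ i + 1) := by
      intro x hx
      simp only [X, mem_filter, mem_univ, true_and] at hx
      obtain ⟨⟨hxU, hxx⟩, hxnU⟩ := hx
      rw [← ih (d + 1) (U ⊔ K ∙ x) (sup_span_singleton_le_orthogonal hs hU hxU hxx) ?_ (by lia)]
      · congr 1
        ext C
        simp [S, bipartiteBelow, and_assoc]
      · have hx0 : x ≠ 0 := fun h => hxnU (h ▸ zero_mem U)
        have hinf : U ⊓ K ∙ x = ⊥ := by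
          rw [← disjoint_iff, Submodule.disjoint_span_singleton' hx0]
          exact hxnU
        have := Submodule.finrank_sup_add_finrank_inf_eq U (K ∙ x)
        rw [hinf, finrank_bot, finrank_span_singleton hx0, hd] at this
        exact this
    have hcount := Finset.sum_card_bipartiteAbove_eq_sum_card_bipartiteBelow
      (s := S) (t := X) (fun C x => x ∈ C)
    rw [Finset.sum_congr rfl hbelow, Finset.sum_const, smul_eq_mul] at hcount
    have h1 : ∑ C ∈ S, #(bipartiteAbove (fun C x => x ∈ C) X C) + #S * q ^ d =
        #S * q ^ (d + (k + 1)) := by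
      rw [← smul_eq_mul (#S), ← smul_eq_mul (#S), ← Finset.sum_const, ← Finset.sum_const,
        ← Finset.sum_add_distrib, Finset.sum_congr rfl habove]
    rw [hcount] at h1
    change #S = _
    rw [prod_range_succ]
    set P := ∏ i ∈ range k, (q ^ i + 1)
    -- Now `|S| (q ^ (d + k + 1) - q ^ d) = |X| P` and
    -- `|X| = q ^ d (q ^ (k + 1) - 1) (q ^ k + 1)`.
    rw [← hX] at hiso
    have hd0 : (q : ℤ) ^ d ≠ 0 := by positivity
    have hk0 : (q : ℤ) ^ (k + 1) - 1 ≠ 0 := by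
      have : (1 : ℤ) < (q : ℤ) ^ (k + 1) := one_lt_pow₀ (by exact_mod_cast hq) (by lia)
      lia
    have hq0 : (q : ℤ) ≠ 0 := by positivity
    zify at hiso h1 ⊢
    have hXval : (#X : ℤ) = q ^ d * (q ^ (k + 1) - 1) * (q ^ k + 1) := by
      apply mul_left_cancel₀ hq0
      linear_combination hiso
    apply mul_left_cancel₀ (mul_ne_zero hd0 hk0)
    rw [hXval] at h1
    linear_combination -h1

end Counting

/-! ### Existence of self-dual codes -/

section Existence

variable {p n : ℕ}

/-- The Euclidean inner product on `𝔽_p^n` as a bilinear form. -/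
abbrev dotForm (p n : ℕ) : BilinForm (ZMod p) (Fin n → ZMod p) :=
  dotProductBilin (ZMod p) (ZMod p)

lemma dotForm_isSymm : (dotForm p n).IsSymm :=
  ⟨fun x y => dotProduct_comm x y⟩

lemma dotForm_nondegenerate : (dotForm p n).Nondegenerate :=
  ⟨fun x hx => dotProduct_eq_zero x hx,
    fun x hx => dotProduct_eq_zero x fun w => (dotProduct_comm x w).trans (hx w)⟩

lemma orthogonal_dotForm (C : Submodule (ZMod p) (Fin n → ZMod p)) :
    (dotForm p n).orthogonal C = dualCode C :=
  rfl

/-- A matrix `M` with `M Mᵀ = -1` makes the code of all words `(x, M x)` self-dual. -/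
lemma exists_dualCode_eq_of_mul_transpose [Fact p.Prime] {ι : Type*} [Fintype ι] [DecidableEq ι]
    (e : ι ⊕ ι ≃ Fin n) (M : Matrix ι ι (ZMod p)) (hM : M * Mᵀ = -1) :
    ∃ C : Submodule (ZMod p) (Fin n → ZMod p), dualCode C = C := by
  let C : Submodule (ZMod p) (Fin n → ZMod p) :=
    { carrier := {c | (fun i => c (e (Sum.inr i))) = M *ᵥ fun i => c (e (Sum.inl i))}
      add_mem' := by
        intro a b ha hb
        exact (congrArg₂ (· + ·) ha hb).trans (Matrix.mulVec_add M _ _).symm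
      zero_mem' := (Matrix.mulVec_zero M).symm
      smul_mem' := by
        intro r a ha
        exact (congrArg (r • ·) ha).trans (Matrix.mulVec_smul M r _).symm }
  have hmem : ∀ c, c ∈ C ↔
    (fun i => c (e (Sum.inr i))) = M *ᵥ fun i => c (e (Sum.inl i)) := fun c => Iff.rfl
  have hdot : ∀ a b : Fin n → ZMod p, a ⬝ᵥ b =
      (fun i => a (e (Sum.inl i))) ⬝ᵥ (fun i => b (e (Sum.inl i))) +
        (fun i => a (e (Sum.inr i))) ⬝ᵥ (fun i => b (e (Sum.inr i))) := by
    intro a b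
    simp only [dotProduct]
    rw [← e.sum_comp, Fintype.sum_sum_type]
  have hM' : Mᵀ * M = -1 := by
    have h : M * -Mᵀ = 1 := by rw [Matrix.mul_neg, hM, neg_neg]
    rw [← neg_neg (Mᵀ * M), ← Matrix.neg_mul, mul_eq_one_comm.1 h]
  refine ⟨C, ?_⟩
  ext y
  rw [hmem]
  set y₁ := fun i => y (e (Sum.inl i)) with hy₁
  set y₂ := fun i => y (e (Sum.inr i)) with hy₂
  have hdual : y ∈ dualCode C ↔ y₁ + Mᵀ *ᵥ y₂ = 0 := by
    constructor
    · intro hy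
      apply dotProduct_eq_zero
      intro x
      have hx := hy (fun j => Sum.elim x (M *ᵥ x) (e.symm j)) (by simp [hmem])
      rw [hdot] at hx
      simp only [Equiv.symm_apply_apply, Sum.elim_inl, Sum.elim_inr] at hx
      rw [dotProduct_comm, dotProduct_add, Matrix.dotProduct_mulVec, Matrix.vecMul_transpose]
      exact hx
    · intro hy c hc
      rw [hmem] at hc
      rw [hdot, hc, ← Matrix.vecMul_transpose, ← Matrix.dotProduct_mulVec, ← dotProduct_add]
      change _ ⬝ᵥ (y₁ + Mᵀ *ᵥ y₂) = 0
      rw [hy, dotProduct_zero]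
  rw [hdual]
  constructor
  · intro h
    have := congrArg (M *ᵥ ·) h
    simp only [Matrix.mulVec_add, Matrix.mulVec_mulVec, hM, Matrix.neg_mulVec, Matrix.one_mulVec,
      Matrix.mulVec_zero] at this
    exact (add_neg_eq_zero.1 this).symm
  · intro h
    rw [h, Matrix.mulVec_mulVec, hM', Matrix.neg_mulVec, Matrix.one_mulVec, add_neg_cancel]

/-- Self-dual codes of every length satisfying the length condition: `M = i` with `i ^ 2 = -1` if
`p ≡ 1 mod 4`, and `M = [a, b; -b, a]` with `a ^ 2 + b ^ 2 = -1` if `p ≡ 3 mod 4`. -/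
lemma exists_dualCode_eq [Fact p.Prime] (hp : p ≠ 2) (h : LengthCondition p n) :
    ∃ C : Submodule (ZMod p) (Fin n → ZMod p), dualCode C = C := by
  have hodd : p % 2 = 1 := (Nat.Prime.eq_two_or_odd Fact.out).resolve_left hp
  rcases (by lia : p % 4 = 1 ∨ p % 4 = 3) with h1 | h3
  · obtain ⟨m, rfl⟩ := h.1 h1
    obtain ⟨i, hi⟩ := ZMod.exists_sq_eq_neg_one_iff.2 (by lia : p % 4 ≠ 3)
    refine exists_dualCode_eq_of_mul_transpose (ι := Fin m)
      (finSumFinEquiv.trans (finCongr (two_mul m).symm)) (i • 1) ?_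
    rw [Matrix.transpose_smul, Matrix.transpose_one, smul_mul_smul_comm, ← hi, mul_one, neg_one_smul]
  · obtain ⟨k, rfl⟩ := h.2 h3
    obtain ⟨a, b, hab⟩ := ZMod.sq_add_sq p (-1)
    refine exists_dualCode_eq_of_mul_transpose (ι := Fin k ⊕ Fin k)
      (Fintype.equivOfCardEq (by simp; lia))
      (Matrix.fromBlocks (a • 1) (b • 1) ((-b) • 1) (a • 1)) ?_
    rw [Matrix.fromBlocks_transpose, Matrix.fromBlocks_multiply, ← Matrix.fromBlocks_one,
      Matrix.fromBlocks_neg]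
    simp only [Matrix.transpose_smul, Matrix.transpose_one, smul_mul_smul_comm, mul_one,
      ← add_smul, Matrix.fromBlocks_inj]
    refine ⟨?_, ?_, ?_, ?_⟩
    · rw [← sq, ← sq, hab, neg_one_smul]
    · rw [show a * -b + b * a = 0 by ring, zero_smul, neg_zero]
    · rw [show -b * a + a * b = 0 by ring, zero_smul, neg_zero]
    · rw [show -b * -b + a * a = a ^ 2 + b ^ 2 by ring, hab, neg_one_smul]

lemma append_dotProduct_append {K : Type*} [CommRing K] {m : ℕ} (a b : Fin n → K)
    (c d : Fin m → K) : Fin.append a c ⬝ᵥ Fin.append b d = a ⬝ᵥ b + c ⬝ᵥ d := by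
  simp [dotProduct, Fin.sum_univ_add]

/-- A self-dual code `C` of length `n` together with one of length `n + 2` gives `-1` as a square:
some self-dual code of length `n + 2` contains all `(c, 0)` with `c ∈ C`, and any further word of
it has the form `(c, u, v)` with `c ∈ C`, `(u, v) ≠ 0` and `u ^ 2 + v ^ 2 = 0`. -/
lemma isSquare_neg_one_of_dualCode_eq [Fact p.Prime]
    {C : Submodule (ZMod p) (Fin n → ZMod p)} (hC : dualCode C = C)
    {L : Submodule (ZMod p) (Fin (n + 2) → ZMod p)} (hL : dualCode L = L) :
    IsSquare (-1 : ZMod p) := by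
  let E : (Fin n → ZMod p) →ₗ[ZMod p] (Fin (n + 2) → ZMod p) :=
    { toFun := fun v => Fin.append v 0
      map_add' := by
        intro a b
        ext j
        refine Fin.addCases (fun i => ?_) (fun i => ?_) j <;> simp
      map_smul' := by
        intro r a
        ext j
        refine Fin.addCases (fun i => ?_) (fun i => ?_) j <;> simp }
  have hE : ∀ v, E v = Fin.append v 0 := fun _ => rfl
  have hEinj : Function.Injective E := by
    intro a b hab
    ext i
    have := congrFun hab (Fin.castAdd 2 i)
    simpa [hE] using this
  have hCC : ∀ c ∈ C, ∀ d ∈ C, c ⬝ᵥ d = 0 := by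
    intro c hc d hd
    exact (hC.symm ▸ hd : d ∈ dualCode C) c hc
  have hU : C.map E ≤ (dotForm p (n + 2)).orthogonal (C.map E) := by
    rintro _ ⟨d, hd, rfl⟩ _ ⟨c, hc, rfl⟩
    change E c ⬝ᵥ E d = 0
    rw [hE, hE, append_dotProduct_append, hCC c hc d hd, dotProduct_zero, add_zero]
  obtain ⟨D, hD, hUD⟩ := exists_orthogonal_eq_and_le dotForm_nondegenerate
    dotForm_isSymm ((orthogonal_dotForm L).trans hL) hU
  have hDr := two_mul_finrank_of_orthogonal_eq dotForm_nondegenerate hD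
  have hCr := two_mul_finrank_of_orthogonal_eq dotForm_nondegenerate
    ((orthogonal_dotForm C).trans hC)
  rw [finrank_fin_fun] at hDr hCr
  have hUr : finrank (ZMod p) (C.map E) = finrank (ZMod p) C :=
    (Submodule.equivMapOfInjective E hEinj C).finrank_eq.symm
  obtain ⟨y, hyD, hyU⟩ : ∃ y ∈ D, y ∉ C.map E := by
    by_contra! hcon
    have := Submodule.finrank_mono (show D ≤ C.map E from hcon)
    lia
  have hyD' : ∀ x ∈ D, x ⬝ᵥ y = 0 := (hD.symm ▸ hyD : y ∈ (dotForm p (n + 2)).orthogonal D)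
  set y₁ : Fin n → ZMod p := fun i => y (Fin.castAdd 2 i)
  set y₂ : Fin 2 → ZMod p := fun i => y (Fin.natAdd n i)
  have hy : y = Fin.append y₁ y₂ := by
    ext j
    refine Fin.addCases (fun i => ?_) (fun i => ?_) j <;> simp [y₁, y₂]
  have hy₁ : y₁ ∈ C := by
    rw [← hC]
    intro c hc
    have := hyD' (E c) (hUD ⟨c, hc, rfl⟩)
    rwa [hy, hE, append_dotProduct_append, zero_dotProduct, add_zero] at this
  have hq : y₂ 0 * y₂ 0 + y₂ 1 * y₂ 1 = 0 := by
    have := hyD' y hyD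
    rwa [hy, append_dotProduct_append, hCC y₁ hy₁ y₁ hy₁, zero_add, dotProduct,
      Fin.sum_univ_two] at this
  have h1 : y₂ 1 ≠ 0 := by
    intro h1
    have h0 : y₂ 0 = 0 := by simpa [h1] using hq
    apply hyU
    refine ⟨y₁, hy₁, ?_⟩
    rw [hE, hy]
    congr 1
    ext i
    fin_cases i
    · exact h0.symm
    · exact h1.symm
  refine ⟨y₂ 0 / y₂ 1, ?_⟩
  field_simp
  linear_combination -hq

theorem selfDualCodes_nonempty_iff [Fact p.Prime] (hp : p ≠ 2) :
    (selfDualCodes p n).Nonempty ↔ LengthCondition p n := by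
  constructor
  · rintro ⟨C, hC⟩
    have hC := ((mem_selfDualCodes C).1 hC).symm
    have hr := two_mul_finrank_of_orthogonal_eq dotForm_nondegenerate
      ((orthogonal_dotForm C).trans hC)
    rw [finrank_fin_fun] at hr
    refine ⟨fun _ => ⟨_, hr.symm⟩, fun h3 => ?_⟩
    by_contra h4
    obtain ⟨L, hL⟩ := exists_dualCode_eq (n := n + 2) hp ⟨fun _ => by lia, fun _ => by lia⟩
    exact ZMod.exists_sq_eq_neg_one_iff.1 (isSquare_neg_one_of_dualCode_eq hC hL) h3
  · intro h
    obtain ⟨C, hC⟩ := exists_dualCode_eq hp h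
    exact ⟨C, (mem_selfDualCodes C).2 hC.symm⟩

end Existence

/-! ### Words with prescribed letter counts -/

section Multinomial

open Classical in
/-- The number of words with prescribed letter counts `A` is the multinomial coefficient: both
sides are the coefficient of `x^A` in `(∑_v x_v) ^ |ι|`. -/
theorem card_filter_card_fiber_eq {ι σ : Type*} [Fintype ι] [Fintype σ] (A : σ → ℕ)
    (hA : ∑ v, A v = Fintype.card ι) :
    #{f : ι → σ | (fun v => #{j | f j = v}) = A} = Nat.multinomial univ A := by
  let d : σ →₀ ℕ := Finsupp.equivFunOnFinite.symm A
  have hexp : (∑ v, MvPolynomial.X v : MvPolynomial σ ℕ) ^ Fintype.card ι =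
      ∑ f : ι → σ, ∏ v, MvPolynomial.X v ^ #{j | f j = v} := by
    rw [← Finset.card_univ (α := ι), ← Finset.prod_const, Finset.prod_univ_sum,
      Fintype.piFinset_univ]
    refine Finset.sum_congr rfl fun f _ => ?_
    rw [← Finset.prod_fiberwise univ f]
    refine Finset.prod_congr rfl fun v _ => ?_
    rw [← Finset.prod_const]
    exact Finset.prod_congr rfl fun j hj => by rw [(mem_filter.1 hj).2]
  have h := congrArg (MvPolynomial.coeff d) hexp
  have hd : d.sum (fun _ m => m) = Fintype.card ι := by
    rw [← hA, Finsupp.sum_fintype _ _ fun _ => rfl]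
    rfl
  rw [MvPolynomial.coeff_sum_X_pow_of_fintype, if_pos hd,
    Finsupp.multinomial_eq_of_support_subset (Finset.subset_univ d.support),
    MvPolynomial.coeff_sum] at h
  rw [card_filter]
  refine Eq.trans (Finset.sum_congr rfl fun f _ => ?_) h.symm
  rw [MvPolynomial.coeff_prod_X_pow]
  refine if_congr ?_ rfl rfl
  constructor
  · rintro rfl
    ext v
    simp [d]
  · intro hf
    ext v
    have := DFunLike.congr_fun hf v
    simpa [d] using this.symm

end Multinomial

/-! ### Tuples of words and admissibility -/

section WordTuples

variable {p n g : ℕ}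

lemma wt_eq_card (c : Fin g → Fin n → ZMod p) (v : Fin g → ZMod p) :
    wt c v = #{j | (fun i => c i j) = v} := by
  simp only [wt, funext_iff]

lemma sum_wt [NeZero p] (c : Fin g → Fin n → ZMod p) : ∑ v, wt c v = n := by
  simp only [wt_eq_card]
  rw [← Finset.card_eq_sum_card_fiberwise (by simp), Finset.card_univ, Fintype.card_fin]

lemma sum_wt_mul [NeZero p] (c : Fin g → Fin n → ZMod p) (φ : (Fin g → ZMod p) → ZMod p) :
    ∑ v, (wt c v : ZMod p) * φ v = ∑ j, φ fun i => c i j := by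
  rw [← Finset.sum_fiberwise univ (fun j i => c i j)]
  refine Finset.sum_congr rfl fun v _ => ?_
  rw [wt_eq_card, ← nsmul_eq_mul, ← Finset.sum_const]
  exact Finset.sum_congr rfl fun j hj => by rw [(mem_filter.1 hj).2]

open Classical in
lemma card_filter_wt_eq [NeZero p] (A : (Fin g → ZMod p) → ℕ) (hA : ∑ v, A v = n) :
    (#{c : Fin g → Fin n → ZMod p | wt c = A} : ℚ) = tupleMultinomial n A := by
  have h1 : #{c : Fin g → Fin n → ZMod p | wt c = A} = Nat.multinomial univ A := by
    rw [← card_filter_card_fiber_eq (ι := Fin n) A (by rw [hA, Fintype.card_fin])]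
    refine Finset.card_equiv (Equiv.piComm _) fun c => ?_
    simp only [mem_filter, mem_univ, true_and]
    rw [show wt c = _ from funext (wt_eq_card c)]
    convert! Iff.rfl
  have h2 := Nat.multinomial_spec univ A
  rw [hA] at h2
  rw [h1, tupleMultinomial, eq_div_iff (by positivity), ← h2]
  push_cast
  ring

/-- The rank of the matrix with rows `c⁽ⁱ⁾` is the dimension of the span of its columns, which are
the vectors `v` with `wt_v(c) > 0`. -/
lemma tupleDim_wt [Fact p.Prime] (c : Fin g → Fin n → ZMod p) :
    tupleDim (wt c) = finrank (ZMod p) (Submodule.span (ZMod p) (Set.range c)) := by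
  have h := (Matrix.rank_eq_finrank_span_cols (Matrix.of c)).symm.trans
    (Matrix.rank_eq_finrank_span_row (Matrix.of c))
  have hset : {v : Fin g → ZMod p | 0 < wt c v} = Set.range (Matrix.of c).col := by
    ext v
    rw [Set.mem_ofPred_eq, wt_eq_card, Finset.card_pos]
    simp only [Finset.Nonempty, mem_filter, mem_univ, true_and]
    rfl
  rw [tupleDim, hset]
  exact h

lemma sum_wt_mul_form [NeZero p] (c : Fin g → Fin n → ZMod p)
    (M : Matrix (Fin g) (Fin g) (ZMod p)) :
    ∑ v, (wt c v : ZMod p) * (v ⬝ᵥ (M *ᵥ v)) = ∑ a, ∑ b, M a b * (c a ⬝ᵥ c b) := by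
  rw [sum_wt_mul]
  simp only [dotProduct, Matrix.mulVec, Finset.mul_sum]
  rw [Finset.sum_comm]
  refine Finset.sum_congr rfl fun a _ => ?_
  rw [Finset.sum_comm]
  exact Finset.sum_congr rfl fun b _ => Finset.sum_congr rfl fun j _ => by ring

/-- The congruences on symmetric matrices say that the words are pairwise orthogonal: take
`S = E_{aa}` and `S = E_{ab} + E_{ba}`, using that `2` is invertible. -/
lemma isAdmissible_wt_iff [Fact p.Prime] (hp : p ≠ 2) (hn : LengthCondition p n)
    (c : Fin g → Fin n → ZMod p) :
    IsAdmissible n (wt c) ↔ ∀ a b, c a ⬝ᵥ c b = 0 := by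
  have h2 : (2 : ZMod p) ≠ 0 := by
    have : ringChar (ZMod p) ≠ 2 := by rwa [ZMod.ringChar_zmod_n]
    exact Ring.two_ne_zero this
  simp only [IsAdmissible, sum_wt, hn, true_and, and_self, sum_wt_mul_form]
  constructor
  · intro h a b
    have hS := h (Matrix.single a b 1 + Matrix.single b a 1) (by
      rw [Matrix.IsSymm, Matrix.transpose_add, Matrix.transpose_single, Matrix.transpose_single,
        add_comm])
    have hab : (c a ⬝ᵥ c b) + (c b ⬝ᵥ c a) = 0 := by
      rw [← hS]
      simp [Matrix.single_apply, add_mul, Finset.sum_add_distrib, ite_and]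
    rw [dotProduct_comm (c b), ← two_mul] at hab
    exact (mul_eq_zero.1 hab).resolve_left h2
  · intro h S _
    simp [h]

end WordTuples

/-! ### The average over all self-dual codes -/

section Average

variable {p n g : ℕ}

lemma prod_range_sub_mul_prod_Icc (q : ℚ) {m d : ℕ} (hd : d ≤ m) :
    (∏ i ∈ range (m - d), (q ^ i + 1)) * ∏ i ∈ Icc 1 d, (q ^ ((m : ℤ) - (i : ℤ)) + 1) =
      ∏ i ∈ range m, (q ^ i + 1) := by
  induction d with
  | zero => simp
  | succ d ih =>
    rw [← ih (by lia), Finset.prod_Icc_succ_top (by lia), show m - d = (m - (d + 1)) + 1 by lia,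
      prod_range_succ, ← zpow_natCast q (m - (d + 1)), Nat.cast_sub hd]
    ring

open Classical in
lemma card_selfDualCodes_above [Fact p.Prime] (hp : p ≠ 2)
    (hne : (selfDualCodes p n).Nonempty) {U : Submodule (ZMod p) (Fin n → ZMod p)}
    (hU : U ≤ dualCode U) :
    finrank (ZMod p) U ≤ n / 2 ∧ #{C ∈ selfDualCodes p n | U ≤ C} =
      ∏ i ∈ range (n / 2 - finrank (ZMod p) U), (p ^ i + 1) := by
  obtain ⟨L, hL⟩ := hne
  have hL : (dotForm p n).orthogonal L = L := ((mem_selfDualCodes L).1 hL).symm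
  have h2 : (2 : ZMod p) ≠ 0 := by
    have : ringChar (ZMod p) ≠ 2 := by rwa [ZMod.ringChar_zmod_n]
    exact Ring.two_ne_zero this
  obtain ⟨C, hC, hUC⟩ := exists_orthogonal_eq_and_le dotForm_nondegenerate dotForm_isSymm hL hU
  have hr := two_mul_finrank_of_orthogonal_eq dotForm_nondegenerate hC
  have hle := Submodule.finrank_mono hUC
  have hn : finrank (ZMod p) (Fin n → ZMod p) = n := finrank_fin_fun _
  refine ⟨by lia, ?_⟩
  have h := card_selfDual_above dotForm_nondegenerate dotForm_isSymm h2 hL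
    (n / 2 - finrank (ZMod p) U) _ U hU rfl (by lia)
  rw [ZMod.card] at h
  rw [← h]
  congr 1
  ext D
  simp only [mem_filter, mem_univ, true_and, mem_selfDualCodes, orthogonal_dotForm, eq_comm]

open Classical in
/-- The proportion of self-dual codes that contain given words `c⁽¹⁾, …, c⁽ᵍ⁾`. -/
lemma card_div_card_selfDualCodes [Fact p.Prime] (hp : p ≠ 2)
    (hne : (selfDualCodes p n).Nonempty) (c : Fin g → Fin n → ZMod p) :
    (#{C ∈ selfDualCodes p n | ∀ i, c i ∈ C} : ℚ) / #(selfDualCodes p n) =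
      if IsAdmissible n (wt c) then
        1 / ∏ i ∈ Icc 1 (tupleDim (wt c)), ((p : ℚ) ^ (((n / 2 : ℕ) : ℤ) - (i : ℤ)) + 1)
      else 0 := by
  have hn := (selfDualCodes_nonempty_iff hp).1 hne
  rw [isAdmissible_wt_iff hp hn]
  split_ifs with h
  · have hU : Submodule.span (ZMod p) (Set.range c) ≤
        dualCode (Submodule.span (ZMod p) (Set.range c)) := by
      rw [Submodule.span_le]
      rintro _ ⟨b, rfl⟩ x hx
      induction hx using Submodule.span_induction with
      | mem x hx =>
        obtain ⟨a, rfl⟩ := hx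
        exact h a b
      | zero => exact zero_dotProduct _
      | add x y _ _ hx hy => rw [add_dotProduct, hx, hy, add_zero]
      | smul r x _ hx => rw [smul_dotProduct, hx, smul_zero]
    obtain ⟨hd, hcard⟩ := card_selfDualCodes_above hp hne hU
    have h0 := (card_selfDualCodes_above hp hne
      (U := (⊥ : Submodule (ZMod p) (Fin n → ZMod p))) bot_le).2
    simp only [bot_le, filter_true, finrank_bot, Nat.sub_zero] at h0
    simp only [Submodule.span_le, Set.range_subset_iff, SetLike.mem_coe] at hcard
    rw [hcard, h0, tupleDim_wt]
    simp only [Nat.cast_prod, Nat.cast_add, Nat.cast_pow, Nat.cast_one]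
    rw [← prod_range_sub_mul_prod_Icc (p : ℚ) hd]
    have hpos : ∏ i ∈ range (n / 2 - finrank (ZMod p) (Submodule.span (ZMod p) (Set.range c))),
        ((p : ℚ) ^ i + 1) ≠ 0 := by positivity
    rw [div_mul_cancel_left₀ hpos, one_div]
  · rw [Finset.filter_false_of_mem, card_empty, Nat.cast_zero, zero_div]
    intro C hC hc
    rw [mem_selfDualCodes] at hC
    refine h fun a b => ?_
    exact (hC ▸ hc b : c b ∈ dualCode C) _ (hc a)

open Classical in
/-- Exchanging the sums over codes and over tuples of words. -/
lemma averageEnumerator_eq_sum_words [NeZero p] :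
    averageEnumerator p n g = ∑ c : Fin g → Fin n → ZMod p,
      ((#{C ∈ selfDualCodes p n | ∀ i, c i ∈ C} : ℚ) / #(selfDualCodes p n)) •
        tupleMonomial (wt c) := by
  simp only [averageEnumerator, genusWeightEnumerator, Finset.sum_filter]
  rw [Finset.sum_comm, Finset.smul_sum]
  refine Finset.sum_congr rfl fun c _ => ?_
  rw [← Finset.sum_filter, Finset.sum_const, ← Nat.cast_smul_eq_nsmul ℚ, smul_smul,
    one_div_mul_eq_div]
  rfl

end Average

end CodeAverage

theorem theorem5p2 (p : ℕ) [Fact p.Prime] (hp : p ≠ 2) (n g : ℕ) :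
    ((CodeAverage.selfDualCodes p n).Nonempty ↔ CodeAverage.LengthCondition p n) ∧
    ((CodeAverage.selfDualCodes p n).Nonempty →
      CodeAverage.averageEnumerator p n g =
        ∑ A ∈ CodeAverage.admissibleTuples p n g,
          (1 / (∏ i ∈ Finset.Icc 1 (CodeAverage.tupleDim A),
              ((p : ℚ) ^ (((n / 2 : ℕ) : ℤ) - (i : ℤ)) + 1)) *
            CodeAverage.tupleMultinomial n A) •
            CodeAverage.tupleMonomial A) := by
  classical
  refine ⟨CodeAverage.selfDualCodes_nonempty_iff hp, fun hne => ?_⟩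
  rw [CodeAverage.averageEnumerator_eq_sum_words]
  simp only [CodeAverage.card_div_card_selfDualCodes hp hne]
  rw [← Finset.sum_fiberwise_of_maps_to (t := Finset.piAntidiag Finset.univ n)
    (g := fun c => CodeAverage.wt c)
    (fun c _ => by simp [Finset.mem_piAntidiag, CodeAverage.sum_wt c]),
    CodeAverage.admissibleTuples, Finset.sum_filter]
  refine Finset.sum_congr rfl fun A hA => ?_
  have hA : ∑ v, A v = n := (Finset.mem_piAntidiag.1 hA).1
  rw [Finset.sum_congr rfl fun c hc => by rw [(Finset.mem_filter.1 hc).2], Finset.sum_const,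
    ← Nat.cast_smul_eq_nsmul ℚ, CodeAverage.card_filter_wt_eq A hA]
  split_ifs
  · rw [smul_smul, mul_comm]
  · rw [zero_smul, smul_zero]
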